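/- Let $G=(V,E)$ be a finite acyclic directed graph (multiple channels allowed) with a single source $s$ and a set $T\not\ni s$ of sink nodes, let $\mathcal F$ be a finite field, and let $w$ be the information rate. For a node $t$ let $C_t$ be the minimum cut capacity between $s$ and $t$; assume $w\le C_t$ for the sink $t\in T$ under consideration. In random linear network coding the local encoding coefficients $k_{d,e}\in\mathcal F$, one for each pair of channels $(d,e)$ such that $d$ enters the node that $e$ leaves, are independent and uniformly distributed on $\mathcal F$; here $w$ imaginary channels, whose global encoding kernels are the standard basis vectors of $\mathcal F^w$, are regarded as entering $s$, and the global encoding kernel of a channel $e\in E$ is $f_e=\sum_d k_{d,e}f_d$, summed over all channels $d$ that enter the tail of $e$. Let $F_t=(f_e : e \text{ enters } t)$ be the decoding matrix at $t$ and let $P_{e_t}=\Pr(\operatorname{Rank}(F_t)<w)$ be the failure probability at $t$. (i) Let $r$ be the number of internal nodes (nodes other than $s$ and $t$) in some collection of $w$ channel-disjoint paths from $s$ to $t$. If $n$ is an integer with $r\le n$, then $$P_{e_t}\le 1-\Big[\prod_{i=1}^{w}\Big(1-\frac1{|\mathcal F|^i}\Big)\Big]^{n+1}.$$ (ii) In particular,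 if no directed path leads from another sink to $t$ (so that the internal nodes of all paths from $s$ to $t$ belong to the set $J=V\setminus(\{s\}\cup T)$ of internal nodes of the network), then $$P_{e_t}\le 1-\Big[\prod_{i=1}^{w}\Big(1-\frac1{|\mathcal F|^i}\Big)\Big]^{|J|+1}.$$ -/

import Mathlib

open MeasureTheory ProbabilityTheory

/-- A single-source communication network: a finite acyclic directed multigraph with nodes `V` and
channels `E` (finiteness enters through `Fintype` instances), a source node and a set of sinks. -/
structure CodingNetwork (V E : Type*) where
  /-- the node that a channel leaves -/
  tail : E → V
  /-- the node that a channel enters -/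
  head : E → V
  /-- the unique source node -/
  source : V
  /-- the set of sink nodes -/
  sinks : Finset V
  source_notMem_sinks : source ∉ sinks
  /-- there is no directed cycle -/
  acyclic : ∀ v : V, ¬ Relation.TransGen (fun a b => ∃ e : E, tail e = a ∧ head e = b) v v

namespace CodingNetwork

variable {V E : Type*}

/-- `a` and `b` are joined by a channel from `a` to `b`. -/
def Adj (N : CodingNetwork V E) (a b : V) : Prop := ∃ e : E, N.tail e = a ∧ N.head e = b

/-- The internal nodes of the network: all nodes except the source and the sinks. -/
noncomputable def internalNodes [Fintype V] (N : CodingNetwork V E) : Finset V := by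
  classical exact {v | v ≠ N.source ∧ v ∉ N.sinks}

/-! Cuts and paths -/

/-- The capacity of the cut `(S, Sᶜ)`: the number of channels that lead from `S` out of `S`. -/
noncomputable def cutCapacity [Fintype E] (N : CodingNetwork V E) (S : Set V) : ℕ := by
  classical exact (Finset.univ.filter fun e : E => N.tail e ∈ S ∧ N.head e ∉ S).card

/-- The minimum cut capacity between the source and the node `t` (used for `t` a sink, so that there
is at least one cut). -/
noncomputable def minCut [Fintype E] (N : CodingNetwork V E) (t : V) : ℕ :=
  sInf {c | ∃ S : Set V, N.source ∈ S ∧ t ∉ S ∧ c = N.cutCapacity S}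

/-- `p` is the list of successive channels of a directed path from `a` to `b`. (The network being
acyclic, no node is visited twice.) -/
structure IsPath (N : CodingNetwork V E) (a b : V) (p : List E) : Prop where
  ne_nil : p ≠ []
  chain : p.IsChain fun d e => N.head d = N.tail e
  tail_first : N.tail (p.head ne_nil) = a
  head_last : N.head (p.getLast ne_nil) = b

/-- `P` is a collection of `w` pairwise channel-disjoint paths from the source to `t`. -/
structure IsDisjointPaths (N : CodingNetwork V E) (t : V) {w : ℕ} (P : Fin w → List E) :
    Prop where
  isPath : ∀ j, N.IsPath N.source t (P j)
  disjoint : Pairwise fun i j => (P i).Disjoint (P j)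

/-- The internal nodes of a collection of paths from the source to `t`: the nodes other than the
source and `t` through which at least one of the paths passes. -/
noncomputable def pathInternalNodes [Fintype V] (N : CodingNetwork V E) (t : V) {w : ℕ}
    (P : Fin w → List E) : Finset V := by
  classical exact {v | v ≠ N.source ∧ v ≠ t ∧ ∃ j, ∃ e ∈ P j, N.tail e = v ∨ N.head e = v}

/-! Linear network coding -/

/-- The node at which an incoming channel arrives. Besides the channels in `E` there are `w`
imaginary channels, indexed by `Fin w`, which arrive at the source and carry the source symbols. -/
def inHead (N : CodingNetwork V E) (w : ℕ) : Fin w ⊕ E → V :=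
  Sum.elim (fun _ => N.source) N.head

/-- The adjacent pairs of channels `(d, e)`: `d` (possibly imaginary) arrives at the node that the
channel `e` leaves. -/
def AdjPair (N : CodingNetwork V E) (w : ℕ) : Type _ :=
  {p : (Fin w ⊕ E) × E // N.inHead w p.1 = N.tail p.2}

/-- The channel `d` feeds into the channel `e`. -/
def Feeds (N : CodingNetwork V E) (d e : E) : Prop := N.head d = N.tail e

theorem wellFounded_feeds [Fintype V] (N : CodingNetwork V E) : WellFounded N.Feeds := by
  let r : V → V → Prop := Relation.TransGen (fun a b => ∃ e : E, N.tail e = a ∧ N.head e = b)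
  have : IsTrans V r := ⟨fun _ _ _ h h' => Relation.TransGen.trans h h'⟩
  have : Std.Irrefl r := ⟨N.acyclic⟩
  have h : WellFounded r := Finite.wellFounded_of_trans_of_irrefl r
  exact Subrelation.wf (r := InvImage r N.tail)
    (fun {d _} hde => Relation.TransGen.single ⟨d, rfl, hde⟩) (InvImage.wf N.tail h)

open Classical in
/-- The global encoding kernel `f_e` of the channel `e` for the local encoding coefficients `k`,
determined by `f_e = ∑ k_{d,e} f_d` over the channels `d` (imaginary ones included) that arrive at
the tail of `e`; the kernels of the imaginary channels are the standard basis vectors. -/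
noncomputable def kernel [Fintype V] [Fintype E] {F : Type*} [Field F] (N : CodingNetwork V E)
    {w : ℕ} (k : N.AdjPair w → F) : E → Fin w → F :=
  N.wellFounded_feeds.fix fun e f =>
    ∑ d : {d : Fin w ⊕ E // N.inHead w d = N.tail e},
      k ⟨(d.1, e), d.2⟩ •
        (match d with
          | ⟨Sum.inl j, _⟩ => Pi.single j 1
          | ⟨Sum.inr d', h⟩ => f d' h)

open Classical in
/-- The recursion that determines the global encoding kernels. -/
theorem kernel_eq [Fintype V] [Fintype E] {F : Type*} [Field F] (N : CodingNetwork V E)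
    {w : ℕ} (k : N.AdjPair w → F) (e : E) :
    N.kernel k e = ∑ d : {d : Fin w ⊕ E // N.inHead w d = N.tail e},
      k ⟨(d.1, e), d.2⟩ • Sum.elim (fun j => Pi.single j 1) (N.kernel k) d.1 := by
  rw [kernel, WellFounded.fix_eq]
  refine Finset.sum_congr rfl fun d _ => ?_
  rcases d with ⟨d | d, h⟩ <;> rfl

/-- The decoding matrix `F_t` at the node `t`: its columns are the global encoding kernels of the
incoming channels of `t`. -/
noncomputable def decodingMatrix [Fintype V] [Fintype E] {F : Type*} [Field F]
    (N : CodingNetwork V E) {w : ℕ} (k : N.AdjPair w → F) (t : V) :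
    Matrix (Fin w) {e : E // N.head e = t} F :=
  Matrix.of fun i e => N.kernel k e.1 i

/-! Random linear network coding -/

/-- Random linear network coding: the local encoding coefficients are independent random variables,
each uniformly distributed on the base field. -/
structure IsRandomCoding (N : CodingNetwork V E) {w : ℕ} {F : Type*} [Fintype F]
    [MeasurableSpace F] {Ω : Type*} [MeasurableSpace Ω] (μ : Measure Ω)
    (k : N.AdjPair w → Ω → F) : Prop where
  measurable : ∀ p, Measurable (k p)
  indep : iIndepFun k μ
  uniform : ∀ p a, μ.real (k p ⁻¹' {a}) = 1 / (Fintype.card F : ℝ)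

open Classical in
/-- The failure probability at the node `t`: the probability that the decoding matrix at `t` has
rank less than the information rate `w`. -/
noncomputable def failureProb [Fintype V] [Fintype E] (N : CodingNetwork V E) {w : ℕ}
    {F : Type*} [Field F] {Ω : Type*} [MeasurableSpace Ω] (μ : Measure Ω)
    (k : N.AdjPair w → Ω → F) (t : V) : ℝ :=
  μ.real {ω | (N.decodingMatrix (fun p => k p ω) t).rank < w}

end CodingNetwork

/-! Follow `w` channel-disjoint paths from the source to `t`, one node at a time in topological
order, keeping one current channel on each path. The square matrix of current kernels starts as the
identity, at the imaginary channels. When `v` is processed, the `s` paths that leave `v` exchange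
their current channel for the next one. If the old matrix is invertible, then relative to its
columns the new one is block triangular, with an identity block and an `s × s` block that is a fixed
matrix plus a uniform one. So invertibility survives with conditional probability `∏_{i ≤ s} (1 -
q⁻ⁱ)`, where `q` is the field size, and this is at least the product up to `w`. There is one step
per node that the paths leave: the source and at most `n` internal nodes. At the end the current
channels enter `t`, and the decoding matrix has rank `w`.

Conditioning is replaced by counting coefficient vectors: `mul_card_le_card_of_translates` and
`Matrix.card_det_block_ne_zero` give the one-node step `mul_card_cutMatrix_le`, which
`pow_mul_card_cutMatrix_le` iterates. For the second bound, Menger's theorem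
(`exists_isDisjointPaths`) supplies the paths, and none of their internal nodes is a sink. -/

namespace CodingNetwork

variable {V E : Type*}

/-! ### Walks as lists of channels -/

/-- `N.Walk a l b` says that `l` is the list of successive channels of a possibly empty walk from
`a` to `b`. -/
def Walk (N : CodingNetwork V E) : V → List E → V → Prop
  | a, [], b => a = b
  | a, e :: l, b => N.tail e = a ∧ N.Walk (N.head e) l b

theorem walk_of_chain (N : CodingNetwork V E) {b : V} :
    ∀ (l : List E) (e : E), (e :: l).IsChain (fun d e => N.head d = N.tail e) →
      N.head ((e :: l).getLast (List.cons_ne_nil e l)) = b → N.Walk (N.tail e) (e :: l) b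
  | [], _, _, hb => ⟨rfl, hb⟩
  | d :: l, e, hc, hb => by
      rw [List.isChain_cons_cons] at hc
      refine ⟨rfl, ?_⟩
      rw [hc.1]
      exact walk_of_chain N l d hc.2 (by simpa using hb)

theorem Walk.chain {N : CodingNetwork V E} {b : V} :
    ∀ {l : List E} {a : V}, N.Walk a l b → l.IsChain fun d e => N.head d = N.tail e
  | [], _, _ => List.isChain_nil
  | [_], _, _ => List.isChain_singleton _
  | _ :: _ :: _, _, h => List.isChain_cons_cons.2 ⟨h.2.1.symm, Walk.chain h.2⟩

theorem Walk.head_getLast {N : CodingNetwork V E} {b : V} :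
    ∀ {l : List E} {a : V}, N.Walk a l b → ∀ hl : l ≠ [], N.head (l.getLast hl) = b
  | [], _, _, hl => absurd rfl hl
  | [_], _, h, _ => h.2
  | _ :: _ :: _, _, h, _ => by
      rw [List.getLast_cons (List.cons_ne_nil _ _)]
      exact Walk.head_getLast h.2 _

theorem IsPath.walk {N : CodingNetwork V E} {a b : V} {p : List E} (h : N.IsPath a b p) :
    N.Walk a p b := by
  obtain ⟨hne, hc, ha, hb⟩ := h
  cases p with
  | nil => exact absurd rfl hne
  | cons e l =>
    rw [← ha]
    exact walk_of_chain N l e hc hb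

theorem Walk.isPath {N : CodingNetwork V E} {a b : V} {p : List E} (h : N.Walk a p b)
    (hab : a ≠ b) : N.IsPath a b p := by
  cases p with
  | nil => exact absurd h hab
  | cons e l =>
    exact ⟨List.cons_ne_nil e l, h.chain, h.1, h.head_getLast _⟩

/-- Links walks to reachability, so that acyclicity can be applied to them. -/
theorem Walk.reflTransGen_head {N : CodingNetwork V E} {b : V} :
    ∀ {l : List E} {a : V}, N.Walk a l b → ∀ e ∈ l,
      Relation.ReflTransGen N.Adj a (N.tail e) ∧ Relation.ReflTransGen N.Adj (N.head e) b
  | [], _, _, e, he => by simp at he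
  | d :: l, a, h, e, he => by
      have had : N.Adj a (N.head d) := ⟨d, h.1, rfl⟩
      rcases List.mem_cons.1 he with rfl | he
      · refine ⟨h.1 ▸ .refl, ?_⟩
        cases l with
        | nil => exact h.2 ▸ .refl
        | cons d' l =>
          have := Walk.reflTransGen_head h.2 d' (by simp)
          rw [← h.2.1]
          exact Relation.ReflTransGen.head ⟨d', rfl, rfl⟩ this.2
      · have := Walk.reflTransGen_head h.2 e he
        exact ⟨Relation.ReflTransGen.head had this.1, this.2⟩

/-! ### Menger's theorem -/

open Classical in
/-- If, except at `t`, the number of tokens at a node plus the number of incoming channels in `X`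
never exceeds the number of outgoing channels in `X`, the tokens can be moved to `t` along
channel-disjoint walks in `X`. -/
theorem exists_disjoint_walks (N : CodingNetwork V E) (t : V) {w : ℕ} :
    ∀ (m : ℕ) (X : Finset E) (a : Fin w → V), X.card = m →
      (∀ v ≠ t, (∑ j, if a j = v then 1 else 0) + (∑ e ∈ X, if N.head e = v then 1 else 0) ≤
        ∑ e ∈ X, if N.tail e = v then 1 else 0) →
      ∃ Q : Fin w → List E, (∀ j, N.Walk (a j) (Q j) t) ∧ (∀ j, ∀ e ∈ Q j, e ∈ X) ∧
        Pairwise fun i j => (Q i).Disjoint (Q j) := by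
  intro m
  induction m with
  | zero =>
    intro X a hX h
    rw [Finset.card_eq_zero] at hX
    subst hX
    refine ⟨fun _ => [], fun j => ?_, by simp, fun i j _ => by simp⟩
    by_contra hj
    have h1 := h (a j) hj
    have h2 : (1 : ℕ) ≤ ∑ i, if a i = a j then 1 else 0 := by
      refine le_trans ?_ (Finset.single_le_sum (f := fun i => if a i = a j then 1 else 0)
        (fun _ _ => Nat.zero_le _) (Finset.mem_univ j))
      simp
    simp only [Finset.sum_empty] at h1
    omega
  | succ m ih =>
    intro X a hX h
    by_cases hall : ∀ j, a j = t
    · exact ⟨fun _ => [], hall, by simp, fun i j _ => by simp⟩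
    push Not at hall
    obtain ⟨j, hj⟩ := hall
    have h1 := h (a j) hj
    have h2 : (1 : ℕ) ≤ ∑ i, if a i = a j then 1 else 0 := by
      refine le_trans ?_ (Finset.single_le_sum (f := fun i => if a i = a j then 1 else 0)
        (fun _ _ => Nat.zero_le _) (Finset.mem_univ j))
      simp
    have h3 : ∃ e ∈ X, N.tail e = a j := by
      by_contra hno
      push Not at hno
      have : (∑ e ∈ X, if N.tail e = a j then 1 else 0) = 0 :=
        Finset.sum_eq_zero fun e he => if_neg (hno e he)
      omega
    obtain ⟨e, heX, he⟩ := h3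
    -- Move token `j` across `e` and delete `e`. At the tail of `e` a token and an outgoing channel
    -- disappear; at its head a token replaces an incoming channel. The inequality persists.
    obtain ⟨Q, hQ, hQX, hQd⟩ := ih (X.erase e) (Function.update a j (N.head e))
      (by rw [Finset.card_erase_of_mem heX, hX]; rfl) (by
        intro v hv
        have h4 := h v hv
        rw [← Finset.add_sum_erase _ _ heX,
          ← Finset.add_sum_erase (s := X) (fun e => if N.tail e = v then 1 else 0) heX,
          ← Finset.add_sum_erase _ _ (Finset.mem_univ j)] at h4
        rw [← Finset.add_sum_erase _ _ (Finset.mem_univ j)]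
        have h5 : (∑ i ∈ Finset.univ.erase j,
            if Function.update a j (N.head e) i = v then 1 else 0) =
            ∑ i ∈ Finset.univ.erase j, if a i = v then 1 else 0 :=
          Finset.sum_congr rfl fun i hi => by
            rw [Function.update_of_ne (Finset.ne_of_mem_erase hi)]
        rw [h5, Function.update_self]
        rw [he] at h4
        omega)
    have hQe : ∀ i, e ∉ Q i := fun i hi => by simpa using hQX i e hi
    refine ⟨Function.update Q j (e :: Q j), fun i => ?_, fun i d hd => ?_, fun i i' hii' => ?_⟩
    · by_cases hij : i = j
      · subst hij
        have := hQ i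
        rw [Function.update_self] at this ⊢
        exact ⟨he, this⟩
      · have := hQ i
        rwa [Function.update_of_ne hij] at this ⊢
    · by_cases hij : i = j
      · subst hij
        rw [Function.update_self] at hd
        rcases List.mem_cons.1 hd with rfl | hd
        · exact heX
        · exact Finset.mem_of_mem_erase (hQX _ _ hd)
      · rw [Function.update_of_ne hij] at hd
        exact Finset.mem_of_mem_erase (hQX _ _ hd)
    · change (Function.update Q j (e :: Q j) i).Disjoint (Function.update Q j (e :: Q j) i')
      have : (Q i).Disjoint (Q i') := hQd hii'
      by_cases hij : i = j
      · subst hij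
        rw [Function.update_self, Function.update_of_ne hii'.symm, List.disjoint_cons_left]
        exact ⟨hQe _, this⟩
      · rw [Function.update_of_ne hij]
        by_cases hij' : i' = j
        · subst hij'
          rw [Function.update_self, List.disjoint_cons_right]
          exact ⟨hQe _, this⟩
        · rwa [Function.update_of_ne hij']

open Classical in
/-- The number of channels in `X` that cross the cut `(A, Aᶜ)`. -/
noncomputable def cutSum (N : CodingNetwork V E) (X : Finset E) (A : Finset V) : ℕ :=
  ∑ e ∈ X, if N.tail e ∈ A ∧ N.head e ∉ A then 1 else 0

-- Submodularity holds channel by channel, by checking which endpoints lie in `A` and in `B`.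
open Classical in
theorem cutSum_union_add_inter_le (N : CodingNetwork V E) (X : Finset E) (A B : Finset V) :
    N.cutSum X (A ∪ B) + N.cutSum X (A ∩ B) ≤ N.cutSum X A + N.cutSum X B := by
  unfold cutSum
  rw [← Finset.sum_add_distrib, ← Finset.sum_add_distrib]
  refine Finset.sum_le_sum fun e _ => ?_
  simp only [Finset.mem_union, Finset.mem_inter]
  by_cases h1 : N.tail e ∈ A <;> by_cases h2 : N.tail e ∈ B <;> by_cases h3 : N.head e ∈ A <;>
    by_cases h4 : N.head e ∈ B <;> simp [h1, h2, h3, h4]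

-- Moving `v` to the source side removes its incoming channels from the cut, all of which came from
-- `A`, and adds at most its outgoing ones.
open Classical in
theorem cutSum_insert_add_le (N : CodingNetwork V E) (X : Finset E) (A : Finset V) (v : V)
    (hv : v ∉ A) (hin : ∀ e ∈ X, N.head e = v → N.tail e ∈ A) :
    N.cutSum X (insert v A) + (∑ e ∈ X, if N.head e = v then 1 else 0) ≤
      N.cutSum X A + ∑ e ∈ X, if N.tail e = v then 1 else 0 := by
  unfold cutSum
  rw [← Finset.sum_add_distrib, ← Finset.sum_add_distrib]
  refine Finset.sum_le_sum fun e he => ?_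
  have := hin e he
  simp only [Finset.mem_insert]
  by_cases h3 : N.head e = v
  · simp [h3, this h3, hv]
  · by_cases h1 : N.tail e ∈ A <;> by_cases h2 : N.tail e = v <;> by_cases h4 : N.head e ∈ A <;>
      simp [h1, h2, h3, h4]

open Classical in
/-- **Menger's theorem** for channel-disjoint paths. -/
theorem exists_isDisjointPaths [Fintype V] [Fintype E] (N : CodingNetwork V E) {t : V}
    (ht : N.source ≠ t) {w : ℕ} (hw : w ≤ N.minCut t) :
    ∃ P : Fin w → List E, N.IsDisjointPaths t P := by
  let good : Finset E → Prop := fun X => ∀ A : Finset V, N.source ∈ A → t ∉ A → w ≤ N.cutSum X A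
  have huniv : good Finset.univ := fun A hs hA => by
    refine hw.trans (Nat.sInf_le ⟨(A : Set V), by simpa using hs, by simpa using hA, ?_⟩)
    rw [cutSum, cutCapacity, Finset.card_filter]
    simp only [Finset.mem_coe]
  -- A minimal channel set with all cuts at least `w`: deleting any channel breaks some cut, so each
  -- channel crosses a cut of value exactly `w`.
  obtain ⟨X, hX, hmin⟩ := exists_minimal_of_wellFoundedLT good ⟨_, huniv⟩
  have htight : ∀ e ∈ X, ∃ A : Finset V, N.source ∈ A ∧ t ∉ A ∧ N.tail e ∈ A ∧ N.head e ∉ A ∧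
      N.cutSum X A = w := by
    intro e he
    have hng : ¬ good (X.erase e) := fun hg =>
      absurd (hmin hg (Finset.erase_subset e X) he) (by simp)
    simp only [good] at hng
    push Not at hng
    obtain ⟨A, hs, hA, hlt⟩ := hng
    have h1 := hX A hs hA
    have h2 : N.cutSum X A = (if N.tail e ∈ A ∧ N.head e ∉ A then 1 else 0) +
        N.cutSum (X.erase e) A := by
      unfold cutSum
      rw [← Finset.add_sum_erase _ _ he]
    by_cases h3 : N.tail e ∈ A ∧ N.head e ∉ A
    · rw [if_pos h3] at h2
      exact ⟨A, hs, hA, h3.1, h3.2, by omega⟩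
    · rw [if_neg h3] at h2
      omega
  have hcons : ∀ v, v ≠ N.source → v ≠ t →
      (∑ e ∈ X, if N.head e = v then 1 else 0) ≤ ∑ e ∈ X, if N.tail e = v then 1 else 0 := by
    intro v hvs hvt
    by_cases hno : ∃ e ∈ X, N.head e = v
    swap
    · push Not at hno
      rw [Finset.sum_eq_zero fun e he => if_neg (hno e he)]
      exact Nat.zero_le _
    obtain ⟨e₀, he₀, rfl⟩ := hno
    set v := N.head e₀
    obtain ⟨A₀, h01, h02, h03, h04, h05⟩ := htight e₀ he₀
    -- Take a maximal tight cut `A` that excludes `v`. By submodularity its union with a tight cut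
    -- crossed by a channel into `v` is again tight, so by maximality that channel starts in `A`.
    let T : Finset (Finset V) := Finset.univ.filter fun A =>
      N.source ∈ A ∧ t ∉ A ∧ v ∉ A ∧ N.cutSum X A = w
    have hT : ∀ A, A ∈ T ↔ N.source ∈ A ∧ t ∉ A ∧ v ∉ A ∧ N.cutSum X A = w := by simp [T]
    obtain ⟨A, hAT, hAmax⟩ := T.exists_maximal ⟨A₀, (hT _).2 ⟨h01, h02, h04, h05⟩⟩
    obtain ⟨hA1, hA2, hA3, hA4⟩ := (hT _).1 hAT
    have hin : ∀ e ∈ X, N.head e = v → N.tail e ∈ A := by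
      intro e he hev
      obtain ⟨B, hB1, hB2, hB3, hB4, hB5⟩ := htight e he
      rw [hev] at hB4
      have hsub := N.cutSum_union_add_inter_le X A B
      have hi := hX (A ∩ B) (by simp [hA1, hB1]) (by simp [hA2])
      have hu := hX (A ∪ B) (by simp [hA1]) (by simp [hA2, hB2])
      have hmem : A ∪ B ∈ T := (hT _).2 ⟨by simp [hA1], by simp [hA2, hB2], by simp [hA3, hB4],
        by omega⟩
      exact hAmax hmem Finset.subset_union_left (Finset.mem_union_right A hB3)
    have h1 := N.cutSum_insert_add_le X A v hA3 hin
    have h2 := hX (insert v A) (by simp [hA1]) (by simp [hA2, hvt.symm])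
    omega
  have hsource : w + (∑ e ∈ X, if N.head e = N.source then 1 else 0) ≤
      ∑ e ∈ X, if N.tail e = N.source then 1 else 0 := by
    have h1 : (∑ e ∈ X, if N.head e = N.source then 1 else 0) = 0 := by
      refine Finset.sum_eq_zero fun e he => if_neg fun h => ?_
      obtain ⟨A, hA1, _, _, hA4, _⟩ := htight e he
      exact hA4 (h ▸ hA1)
    rw [h1, add_zero]
    refine (hX {N.source} (by simp) (by simpa using ht.symm)).trans ?_
    refine Finset.sum_le_sum fun e _ => ?_
    by_cases h : N.tail e = N.source <;> simp [h]
    split_ifs <;> simp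
  obtain ⟨Q, hQ, -, hQd⟩ := N.exists_disjoint_walks t X.card X (fun _ : Fin w => N.source) rfl (by
    intro v hv
    by_cases hvs : v = N.source
    · subst hvs
      simpa using hsource
    · simpa [Ne.symm hvs] using hcons v hvs hv)
  exact ⟨Q, fun j => (hQ j).isPath ht, hQd⟩

end CodingNetwork

/-! ### Counting by translations, and random matrices over a finite field -/

open Classical in
/-- If each `x ∈ G` is moved into `G'` by at least a fraction `c` of the translations `φ y`, then
`G'` has at least `c` times as many elements as `G`. -/
theorem mul_card_le_card_of_translates {α β : Type*} [AddGroup α] [Fintype β] [Nonempty β]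
    (φ : β → α) (G G' : Finset α) (c : ℝ)
    (h : ∀ x ∈ G, c * Fintype.card β ≤ ((Finset.univ.filter fun y => x + φ y ∈ G').card : ℝ)) :
    c * G.card ≤ G'.card := by
  have h1 : ∑ x ∈ G, (Finset.univ.filter fun y => x + φ y ∈ G').card =
      ∑ y : β, (G.filter fun x => x + φ y ∈ G').card := by
    simp only [Finset.card_filter]
    exact Finset.sum_comm
  -- For fixed `y` the translation is injective, so it carries at most `#G'` elements of `G` into
  -- `G'`.
  have h2 : ∑ y : β, (G.filter fun x => x + φ y ∈ G').card ≤ Fintype.card β * G'.card := by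
    rw [← smul_eq_mul, ← Finset.card_univ, ← Finset.sum_const]
    refine Finset.sum_le_sum fun y _ => ?_
    refine Finset.card_le_card_of_injOn (fun x => x + φ y) (fun x hx => ?_)
      (fun a _ b _ hab => add_right_cancel hab)
    exact (Finset.mem_filter.1 hx).2
  have h3 : (G.card : ℝ) * (c * Fintype.card β) ≤ Fintype.card β * G'.card := by
    calc (G.card : ℝ) * (c * Fintype.card β) = ∑ _x ∈ G, c * Fintype.card β := by simp
      _ ≤ ∑ x ∈ G, ((Finset.univ.filter fun y => x + φ y ∈ G').card : ℝ) := Finset.sum_le_sum h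
      _ ≤ Fintype.card β * G'.card := by
        rw [← Nat.cast_sum, h1]
        exact_mod_cast h2
  have hβ : (0 : ℝ) < Fintype.card β := by exact_mod_cast Fintype.card_pos
  refine le_of_mul_le_mul_left ?_ hβ
  linarith

namespace Matrix

variable {F : Type*} [Field F] [Fintype F] [DecidableEq F]

/-- The order of `GL_m` is `∏_{i < m} (q^m - q^i)`; take `q^m` out of each factor and reindex by `i
↦ m - i`. -/
theorem card_det_ne_zero_fin (m : ℕ) :
    ((Finset.univ.filter fun A : Matrix (Fin m) (Fin m) F => A.det ≠ 0).card : ℝ) =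
      (∏ i ∈ Finset.Icc 1 m, (1 - 1 / (Fintype.card F : ℝ) ^ i)) *
        Fintype.card (Matrix (Fin m) (Fin m) F) := by
  have hq : (Fintype.card F : ℝ) ≠ 0 := by exact_mod_cast Fintype.card_ne_zero
  have h1 : (Finset.univ.filter fun A : Matrix (Fin m) (Fin m) F => A.det ≠ 0).card =
      Nat.card (GL (Fin m) F) := by
    rw [← Fintype.card_subtype, ← Nat.card_eq_fintype_card]
    refine (Nat.card_congr (Equiv.ofBijective
      (fun g : GL (Fin m) F => (⟨g.1, ((Matrix.isUnit_iff_isUnit_det _).1 g.isUnit).ne_zero⟩ :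
        {A : Matrix (Fin m) (Fin m) F // A.det ≠ 0})) ⟨fun a b hab => ?_, fun A => ?_⟩)).symm
    · exact Units.ext (congrArg Subtype.val hab)
    · exact ⟨Matrix.GeneralLinearGroup.mkOfDetNeZero A.1 A.2, rfl⟩
  rw [h1, Matrix.card_GL_field]
  have h2 : Fintype.card (Matrix (Fin m) (Fin m) F) = ∏ _i : Fin m, Fintype.card F ^ m := by
    have : Fintype.card (Matrix (Fin m) (Fin m) F) = Fintype.card (Fin m → Fin m → F) := by
      convert rfl
    rw [this]
    simp
  have h3 : (∏ i ∈ Finset.Icc 1 m, (1 - 1 / (Fintype.card F : ℝ) ^ i)) =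
      ∏ i : Fin m, (1 - 1 / (Fintype.card F : ℝ) ^ (m - (i : ℕ))) := by
    rw [Fin.prod_univ_eq_prod_range (fun i => 1 - 1 / (Fintype.card F : ℝ) ^ (m - i)) m]
    refine Finset.prod_nbij' (fun i => m - i) (fun i => m - i) ?_ ?_ ?_ ?_ ?_
    · intro i hi; rw [Finset.mem_Icc] at hi; rw [Finset.mem_range]; omega
    · intro i hi; rw [Finset.mem_range] at hi; rw [Finset.mem_Icc]; omega
    · intro i hi; rw [Finset.mem_Icc] at hi; omega
    · intro i hi; rw [Finset.mem_range] at hi; omega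
    · intro i hi; rw [Finset.mem_Icc] at hi; rw [Nat.sub_sub_self hi.2]
  rw [h2, h3, Nat.cast_prod, Nat.cast_prod, ← Finset.prod_mul_distrib]
  refine Finset.prod_congr rfl fun i _ => ?_
  rw [Nat.cast_sub (Nat.pow_le_pow_right Fintype.card_pos i.2.le)]
  push_cast
  rw [sub_mul, one_mul, div_mul_eq_mul_div, one_mul]
  congr 1
  rw [eq_div_iff (pow_ne_zero _ hq), ← pow_add]
  congr 1
  omega

theorem card_det_add_ne_zero {n : Type*} [Fintype n] [DecidableEq n] (A : Matrix n n F) :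
    ((Finset.univ.filter fun y : Matrix n n F => (A + y).det ≠ 0).card : ℝ) =
      (∏ i ∈ Finset.Icc 1 (Fintype.card n), (1 - 1 / (Fintype.card F : ℝ) ^ i)) *
        Fintype.card (Matrix n n F) := by
  let f := Fintype.equivFin n
  let g : Matrix n n F ≃ Matrix (Fin (Fintype.card n)) (Fin (Fintype.card n)) F :=
    (Equiv.addLeft A).trans (Matrix.reindex f f)
  rw [Fintype.card_congr g, ← card_det_ne_zero_fin]
  congr 1
  refine Finset.card_equiv g fun y => ?_
  simp [g]

/-- If `M` is invertible and the columns of `M₀` outside `S` are those of `M`, then adding to the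
columns in `S` random combinations of the columns of `M` in `S` gives an invertible matrix with
the same probability that a random square matrix of size `#S` is invertible. -/
theorem card_det_block_ne_zero {n : Type*} [Fintype n] [DecidableEq n] (S : n → Prop)
    [DecidablePred S] (M M₀ : Matrix n n F)
    (hM : M.det ≠ 0) (h : ∀ j, ¬ S j → ∀ i, M₀ i j = M i j) :
    ((Finset.univ.filter fun y : Matrix {j // S j} {j // S j} F =>
        (M₀ + M * Matrix.of fun i j => if h : S i ∧ S j then y ⟨i, h.1⟩ ⟨j, h.2⟩ else 0).det ≠
          0).card : ℝ) =
      (∏ i ∈ Finset.Icc 1 (Fintype.card {j // S j}), (1 - 1 / (Fintype.card F : ℝ) ^ i)) *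
        Fintype.card (Matrix {j // S j} {j // S j} F) := by
  rw [← card_det_add_ne_zero ((M⁻¹ * M₀).toSquareBlockProp S)]
  congr 1
  refine congrArg Finset.card ?_
  ext y
  simp only [Finset.mem_filter, Finset.mem_univ, true_and]
  set Y : Matrix n n F := Matrix.of fun i j => if h : S i ∧ S j then y ⟨i, h.1⟩ ⟨j, h.2⟩ else 0
    with hY
  have hu : IsUnit M.det := isUnit_iff_ne_zero.2 hM
  have h1 : M₀ + M * Y = M * (M⁻¹ * M₀ + Y) := by
    rw [Matrix.mul_add, Matrix.mul_nonsing_inv_cancel_left _ _ hu]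
  -- After factoring out `M`, the columns outside `S` are unit vectors, so the determinant reduces
  -- to that of the `S` block, where `y` is added to a fixed matrix.
  have h2 : ∀ j, ¬ S j → ∀ i, (M⁻¹ * M₀ + Y) i j = (1 : Matrix n n F) i j := by
    intro j hj i
    have : (M⁻¹ * M₀) i j = (M⁻¹ * M) i j := by
      simp only [Matrix.mul_apply]
      exact Finset.sum_congr rfl fun l _ => by rw [h j hj l]
    rw [Matrix.add_apply, this, Matrix.nonsing_inv_mul _ hu]
    simp [hY, hj]
  have h3 : (M⁻¹ * M₀ + Y).det = ((M⁻¹ * M₀).toSquareBlockProp S + y).det := by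
    rw [Matrix.twoBlockTriangular_det' _ S fun i hi j hj => by
      rw [h2 j hj i, Matrix.one_apply_ne]; rintro rfl; exact hj hi]
    have h4 : (M⁻¹ * M₀ + Y).toSquareBlockProp (fun i => ¬ S i) = 1 := by
      ext i j
      rw [Matrix.toSquareBlockProp_def, Matrix.of_apply, h2 _ j.2]
      simp [Matrix.one_apply, Subtype.ext_iff]
    have h5 : (M⁻¹ * M₀ + Y).toSquareBlockProp S = (M⁻¹ * M₀).toSquareBlockProp S + y := by
      ext i j
      simp [Matrix.toSquareBlockProp_def, hY, i.2, j.2]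
    rw [h4, h5, Matrix.det_one, mul_one]
  rw [h1, Matrix.det_mul, h3, mul_ne_zero_iff, and_iff_right hM]

end Matrix

/-! ### Effect on the kernels of shifting coefficients at one node -/

namespace CodingNetwork

variable {V E : Type*}

open Classical in
noncomputable instance [Fintype E] (N : CodingNetwork V E) (w : ℕ) : Fintype (N.AdjPair w) :=
  inferInstanceAs (Fintype {p : (Fin w ⊕ E) × E // N.inHead w p.1 = N.tail p.2})

theorem not_reflTransGen_tail_of_head (N : CodingNetwork V E) {v : V} {e : E} (h : N.head e = v) :
    ¬ Relation.ReflTransGen N.Adj v (N.tail e) := fun h' =>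
  N.acyclic v (Relation.TransGen.tail' h' ⟨e, rfl, h⟩)

variable [Fintype V] [Fintype E] {F : Type*} [Field F] (N : CodingNetwork V E) {w : ℕ}

open Classical in
/-- The global encoding kernel of `e` depends only on the coefficients of channels upstream. -/
theorem kernel_congr (k k' : N.AdjPair w → F) (e : E)
    (h : ∀ p : N.AdjPair w, Relation.ReflTransGen N.Adj (N.tail p.1.2) (N.tail e) → k p = k' p) :
    N.kernel k e = N.kernel k' e := by
  induction e using N.wellFounded_feeds.induction with
  | _ e ih =>
  rw [kernel_eq, kernel_eq]
  refine Finset.sum_congr rfl fun d _ => ?_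
  rw [h ⟨(d.1, e), d.2⟩ .refl]
  rcases d with ⟨d | d, hd⟩
  · rfl
  · simp only [Sum.elim_inr]
    rw [ih d hd fun p hp => h p (hp.tail ⟨d, rfl, hd⟩)]

/-- The global encoding kernels of all channels, imaginary ones included. -/
noncomputable def extKernel (k : N.AdjPair w → F) : Fin w ⊕ E → Fin w → F :=
  Sum.elim (fun j => Pi.single j 1) (N.kernel k)

/-- The square matrix whose columns are the global encoding kernels of the channels `c j`. -/
noncomputable def cutMatrix (k : N.AdjPair w → F) (c : Fin w → Fin w ⊕ E) :
    Matrix (Fin w) (Fin w) F :=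
  Matrix.of fun i j => N.extKernel k (c j) i

open Classical in
/-- The coefficient vector with the entry `y i j` at the pair `(c i, e j)` and zero elsewhere. -/
noncomputable def pairShift {ι : Type*} [Fintype ι] (c : ι → Fin w ⊕ E) (e : ι → E)
    (y : Matrix ι ι F) : N.AdjPair w → F :=
  fun p => ∑ i, ∑ j, if c i = p.1.1 ∧ e j = p.1.2 then y i j else 0

section

variable {ι : Type*} [Fintype ι] (c : ι → Fin w ⊕ E) (e : ι → E) {v : V}

theorem extKernel_add_pairShift (k : N.AdjPair w → F) (he : ∀ j, N.tail (e j) = v)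
    (y : Matrix ι ι F) (d : Fin w ⊕ E)
    (hd : ∀ e', d = Sum.inr e' → ¬ Relation.ReflTransGen N.Adj v (N.tail e')) :
    N.extKernel (k + N.pairShift c e y) d = N.extKernel k d := by
  rcases d with j | d
  · rfl
  · refine N.kernel_congr _ _ d fun p hp => ?_
    rw [Pi.add_apply, pairShift, Finset.sum_eq_zero, add_zero]
    refine fun i _ => Finset.sum_eq_zero fun j _ => if_neg fun hij => ?_
    rw [← hij.2, he j] at hp
    exact hd d rfl hp

-- By acyclicity, the kernels of channels entering `v` ignore the coefficients of channels leaving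
-- `v`. The recursion is therefore affine in `y`, with no higher-order terms.
open Classical in
theorem kernel_add_pairShift (k : N.AdjPair w → F) (hc : ∀ i, N.inHead w (c i) = v)
    (he : ∀ j, N.tail (e j) = v) (hinj : Function.Injective e) (y : Matrix ι ι F) (j : ι) :
    N.kernel (k + N.pairShift c e y) (e j) =
      N.kernel k (e j) + ∑ i, y i j • N.extKernel k (c i) := by
  have h1 : ∀ d : {d : Fin w ⊕ E // N.inHead w d = N.tail (e j)},
      N.extKernel (k + N.pairShift c e y) d.1 = N.extKernel k d.1 := by
    rintro ⟨d, hd⟩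
    refine N.extKernel_add_pairShift c e k he y d fun e' hde => ?_
    subst hde
    exact N.not_reflTransGen_tail_of_head (hd.trans (he j))
  have h2 : ∀ d : {d : Fin w ⊕ E // N.inHead w d = N.tail (e j)},
      N.pairShift c e y ⟨(d.1, e j), d.2⟩ = ∑ i, if c i = d.1 then y i j else 0 := by
    intro d
    refine Finset.sum_congr rfl fun i _ => ?_
    rw [Finset.sum_eq_single j]
    · simp
    · exact fun j' _ hj' => if_neg fun h => hj' (hinj h.2)
    · simp
  rw [kernel_eq, kernel_eq]
  change ∑ d : {d : Fin w ⊕ E // N.inHead w d = N.tail (e j)},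
      (k ⟨(d.1, e j), d.2⟩ + N.pairShift c e y ⟨(d.1, e j), d.2⟩) •
        N.extKernel (k + N.pairShift c e y) d.1 =
    ∑ d : {d : Fin w ⊕ E // N.inHead w d = N.tail (e j)},
      k ⟨(d.1, e j), d.2⟩ • N.extKernel k d.1 + _
  simp only [h1, h2, add_smul, Finset.sum_add_distrib, Finset.sum_smul]
  congr 1
  rw [Finset.sum_comm]
  refine Finset.sum_congr rfl fun i _ => ?_
  rw [Finset.sum_eq_single ⟨c i, (hc i).trans (he j).symm⟩]
  · simp
  · intro d _ hd
    rw [if_neg, zero_smul]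
    exact fun h => hd (Subtype.ext h.symm)
  · simp

end

/-! ### Processing one node -/

variable [Fintype F]

theorem prod_one_sub_inv_pow_nonneg (m : ℕ) :
    0 ≤ ∏ i ∈ Finset.Icc 1 m, (1 - 1 / (Fintype.card F : ℝ) ^ i) := by
  refine Finset.prod_nonneg fun i _ => sub_nonneg.2 ?_
  have : (1 : ℝ) ≤ Fintype.card F := by exact_mod_cast Fintype.card_pos
  exact (div_le_one (by positivity)).2 (one_le_pow₀ this)

theorem prod_one_sub_inv_pow_anti {m n : ℕ} (h : m ≤ n) :
    ∏ i ∈ Finset.Icc 1 n, (1 - 1 / (Fintype.card F : ℝ) ^ i) ≤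
      ∏ i ∈ Finset.Icc 1 m, (1 - 1 / (Fintype.card F : ℝ) ^ i) := by
  have h1 : (1 : ℝ) ≤ Fintype.card F := by exact_mod_cast Fintype.card_pos
  have hsub : Finset.Icc 1 m ⊆ Finset.Icc 1 n := Finset.Icc_subset_Icc_right h
  rw [← Finset.prod_sdiff hsub]
  refine mul_le_of_le_one_left (prod_one_sub_inv_pow_nonneg m) (Finset.prod_le_one ?_ ?_)
  · intro i _
    exact sub_nonneg.2 ((div_le_one (by positivity)).2 (one_le_pow₀ h1))
  · intro i _
    exact sub_le_self _ (by positivity)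

open Classical in
/-- Processing one node: the channels `c j` with `j ∈ S`, which arrive at the node `v`, are
replaced by distinct channels that leave `v`. -/
theorem mul_card_cutMatrix_le (S : Fin w → Prop) (c : Fin w → Fin w ⊕ E) (e : {j // S j} → E)
    {v : V} (hc : ∀ j, S j → N.inHead w (c j) = v) (he : ∀ j, N.tail (e j) = v)
    (hinj : Function.Injective e)
    (hfree : ∀ j e', c j = Sum.inr e' → ¬ Relation.ReflTransGen N.Adj v (N.tail e')) :
    (∏ i ∈ Finset.Icc 1 w, (1 - 1 / (Fintype.card F : ℝ) ^ i)) *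
      (Finset.univ.filter fun k : N.AdjPair w → F => (N.cutMatrix k c).det ≠ 0).card ≤
    (Finset.univ.filter fun k : N.AdjPair w → F =>
      (N.cutMatrix k fun j => if h : S j then Sum.inr (e ⟨j, h⟩) else c j).det ≠ 0).card := by
  set c' : Fin w → Fin w ⊕ E := fun j => if h : S j then Sum.inr (e ⟨j, h⟩) else c j with hc'
  refine mul_card_le_card_of_translates
    (N.pairShift (F := F) (fun i : {j // S j} => c i) e) _ _ _ fun k hk => ?_
  have hk : (N.cutMatrix k c).det ≠ 0 := (Finset.mem_filter.1 hk).2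
  have hM₀ : ∀ j, ¬ S j → ∀ i, N.cutMatrix k c' i j = N.cutMatrix k c i j := fun j hj i => by
    simp [cutMatrix, hc', hj]
  -- The shift itself does not depend on `k`, as translation counting requires; `k` enters only
  -- through the factor `N.cutMatrix k c`.
  have key : ∀ y : Matrix {j // S j} {j // S j} F,
      N.cutMatrix (k + N.pairShift (fun i : {j // S j} => c i) e y) c' =
        N.cutMatrix k c' + N.cutMatrix k c *
          Matrix.of fun i j => if h : S i ∧ S j then y ⟨i, h.1⟩ ⟨j, h.2⟩ else 0 := by
    intro y
    ext i j
    rw [Matrix.add_apply, Matrix.mul_apply]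
    by_cases hj : S j
    · have h1 : c' j = Sum.inr (e ⟨j, hj⟩) := dif_pos hj
      have h2 := congrFun (N.kernel_add_pairShift (fun i : {j // S j} => c i) e k
        (fun i => hc i i.2) he hinj y ⟨j, hj⟩) i
      simp only [cutMatrix, Matrix.of_apply, h1]
      change N.kernel _ _ i = N.kernel _ _ i + _
      rw [h2, Pi.add_apply, Finset.sum_apply]
      congr 1
      have h3 : ∀ l, N.extKernel k (c l) i *
          (if h : S l ∧ S j then y ⟨l, h.1⟩ ⟨j, h.2⟩ else 0) =
          if h : S l then y ⟨l, h⟩ ⟨j, hj⟩ * N.extKernel k (c l) i else 0 := fun l => by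
        by_cases hl : S l
        · simp [hl, hj, mul_comm]
        · simp [hl]
      simp only [h3, Pi.smul_apply, smul_eq_mul]
      rw [← Fintype.sum_subtype_add_sum_subtype S, Finset.sum_eq_zero (s := Finset.univ)
        (f := fun l : {l // ¬ S l} => _) fun l _ => dif_neg l.2, add_zero]
      exact Finset.sum_congr rfl fun l _ => by rw [dif_pos l.2]
    · have h1 : c' j = c j := dif_neg hj
      simp only [cutMatrix, Matrix.of_apply, h1]
      rw [N.extKernel_add_pairShift _ e k he y _ (hfree j)]
      simp [hj]
  have hcount := Matrix.card_det_block_ne_zero S (N.cutMatrix k c) (N.cutMatrix k c') hk hM₀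
  have hle : Fintype.card {j // S j} ≤ w := by
    simpa using Fintype.card_subtype_le S
  refine (mul_le_mul_of_nonneg_right (prod_one_sub_inv_pow_anti hle)
    (Nat.cast_nonneg _)).trans (hcount.symm.trans ?_).le
  refine congrArg (fun s : Finset (Matrix {j // S j} {j // S j} F) => (s.card : ℝ)) ?_
  ext y
  simp only [Finset.mem_filter, Finset.mem_univ, true_and, key]

end CodingNetwork

/-! ### Iteration from the source to the sink, and the probability bound -/

theorem Matrix.rank_submatrix_id_le {m n l R : Type*} [Fintype n] [Fintype l] [CommRing R]
    [StrongRankCondition R] (A : Matrix m n R) (g : l → n) :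
    (A.submatrix id g).rank ≤ A.rank := by
  classical
  have : A.submatrix id g = A * (1 : Matrix n n R).submatrix id g := by
    ext i j
    simp [Matrix.mul_apply, Matrix.one_apply]
  rw [this]
  exact Matrix.rank_mul_le_left _ _

namespace CodingNetwork

variable {V E : Type*}

theorem exists_transGen_minimal [Finite V] (N : CodingNetwork V E) (A : Set V)
    (hA : A.Nonempty) : ∃ v ∈ A, ∀ u ∈ A, ¬ Relation.TransGen N.Adj u v := by
  have : IsTrans V (Relation.TransGen N.Adj) := ⟨fun _ _ _ h h' => h.trans h'⟩
  have : Std.Irrefl (Relation.TransGen N.Adj) := ⟨N.acyclic⟩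
  exact (Finite.wellFounded_of_trans_of_irrefl (Relation.TransGen N.Adj)).has_min A hA

open Classical in
/-- The nodes that the channels of the walks `Q` leave. -/
noncomputable def walkTails [Fintype V] (N : CodingNetwork V E) {w : ℕ} (Q : Fin w → List E) :
    Finset V :=
  Finset.univ.filter fun v => ∃ j, ∃ e ∈ Q j, N.tail e = v

theorem mem_walkTails [Fintype V] (N : CodingNetwork V E) {w : ℕ} {Q : Fin w → List E} {v : V} :
    v ∈ N.walkTails Q ↔ ∃ j, ∃ e ∈ Q j, N.tail e = v := by
  simp [walkTails]

theorem pathInternalNodes_subset_internalNodes [Fintype V] (N : CodingNetwork V E) {w : ℕ}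
    {t : V}
    (h : ∀ t' ∈ N.sinks, ¬ Relation.TransGen N.Adj t' t) {P : Fin w → List E}
    (hP : N.IsDisjointPaths t P) : N.pathInternalNodes t P ⊆ N.internalNodes := by
  intro v hv
  simp only [pathInternalNodes, internalNodes, Finset.mem_filter, Finset.mem_univ,
    true_and] at hv ⊢
  obtain ⟨hvs, hvt, j, e, he, hev⟩ := hv
  refine ⟨hvs, fun hsink => h v hsink ?_⟩
  have h1 := ((hP.isPath j).walk.reflTransGen_head e he).2
  rcases hev with rfl | rfl
  · exact Relation.TransGen.head' ⟨e, rfl, rfl⟩ h1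
  · rcases Relation.reflTransGen_iff_eq_or_transGen.1 h1 with h2 | h2
    · exact absurd h2.symm hvt
    · exact h2

open Classical in
/-- The coefficient vector of a random linear network code is uniformly distributed. -/
theorem IsRandomCoding.measureReal_eq [Fintype E] {F : Type*} [Fintype F]
    [MeasurableSpace F] [MeasurableSingletonClass F] {Ω : Type*} [MeasurableSpace Ω] {μ : Measure Ω} [IsProbabilityMeasure μ]
    {N : CodingNetwork V E} {w : ℕ} {k : N.AdjPair w → Ω → F} (hk : N.IsRandomCoding μ k)
    (B : Finset (N.AdjPair w → F)) :
    μ.real {ω | (fun p => k p ω) ∈ B} = B.card / (Fintype.card (N.AdjPair w → F) : ℝ) := by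
  -- Split the event into disjoint atoms, one per coefficient vector; independence gives them all
  -- the same mass.
  have h1 : {ω | (fun p => k p ω) ∈ B} =
      ⋃ x ∈ B, ⋂ p ∈ (Finset.univ : Finset (N.AdjPair w)), k p ⁻¹' {x p} := by
    ext ω
    simp only [Set.mem_ofPred_eq, Set.mem_iUnion, Set.mem_iInter, Finset.mem_univ, true_implies,
      Set.mem_preimage, Set.mem_singleton_iff, exists_prop]
    exact ⟨fun h => ⟨_, h, fun _ => rfl⟩, fun ⟨x, hx, h⟩ => (funext h : (fun p => k p ω) = x) ▸ hx⟩
  have h2 : ∀ x : N.AdjPair w → F,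
      μ.real (⋂ p ∈ (Finset.univ : Finset (N.AdjPair w)), k p ⁻¹' {x p}) =
        1 / (Fintype.card (N.AdjPair w → F) : ℝ) := by
    intro x
    rw [measureReal_def, hk.indep.measure_inter_preimage_eq_mul _
      fun p _ => measurableSet_singleton (x p), ENNReal.toReal_prod]
    simp only [← measureReal_def, hk.uniform]
    simp
  rw [h1, measureReal_biUnion_finset]
  · simp only [h2]
    rw [Finset.sum_const, nsmul_eq_mul, mul_one_div]
  · intro x _ y _ hxy
    obtain ⟨p, hp⟩ := Function.ne_iff.1 hxy
    refine Set.disjoint_left.2 fun ω hω hω' => hp ?_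
    simp only [Set.mem_iInter, Finset.mem_univ, true_implies, Set.mem_preimage,
      Set.mem_singleton_iff] at hω hω'
    rw [← hω p, hω' p]
  · exact fun x _ => Finset.measurableSet_biInter _ fun p _ =>
      hk.measurable p (measurableSet_singleton _)

variable [Fintype V] [Fintype E] {F : Type*} [Field F] (N : CodingNetwork V E) {w : ℕ}

open Classical in
theorem not_rank_decodingMatrix_lt (k : N.AdjPair w → F) {t : V} (hst : N.source ≠ t)
    (c : Fin w → Fin w ⊕ E) (hc : ∀ j, N.inHead w (c j) = t) (hdet : (N.cutMatrix k c).det ≠ 0) :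
    ¬ (N.decodingMatrix k t).rank < w := by
  have h1 : ∀ j, ∃ e : {e : E // N.head e = t}, c j = Sum.inr e.1 := fun j => by
    have := hc j
    rcases hcj : c j with i | e
    · rw [hcj] at this
      exact absurd this hst
    · rw [hcj] at this
      exact ⟨⟨e, this⟩, rfl⟩
  choose g hg using h1
  have h2 : N.cutMatrix k c = (N.decodingMatrix k t).submatrix id g := by
    ext i j
    simp [cutMatrix, hg, extKernel, decodingMatrix]
  have h3 := Matrix.rank_submatrix_id_le (N.decodingMatrix k t) g
  rw [← h2, Matrix.rank_of_isUnit _ ((Matrix.isUnit_iff_isUnit_det _).2 (isUnit_iff_ne_zero.2 hdet)),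
    Fintype.card_fin] at h3
  exact not_lt.2 h3

variable [Fintype F]

open Classical in
/-- Continuing from the current channels `c` along the walks `Q`, one node at a time. -/
theorem pow_mul_card_cutMatrix_le {t : V} (hst : N.source ≠ t) :
    ∀ (m : ℕ) (Q : Fin w → List E) (c : Fin w → Fin w ⊕ E), (N.walkTails Q).card = m →
      (∀ j, N.Walk (N.inHead w (c j)) (Q j) t) →
      (Pairwise fun i j => (Q i).Disjoint (Q j)) →
      (∀ u ∈ N.walkTails Q, ∀ j e, c j = Sum.inr e →
        ¬ Relation.ReflTransGen N.Adj u (N.tail e)) →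
      (∏ i ∈ Finset.Icc 1 w, (1 - 1 / (Fintype.card F : ℝ) ^ i)) ^ m *
        (Finset.univ.filter fun k : N.AdjPair w → F => (N.cutMatrix k c).det ≠ 0).card ≤
      (Finset.univ.filter fun k : N.AdjPair w → F => ¬ (N.decodingMatrix k t).rank < w).card := by
  intro m
  induction m with
  | zero =>
    intro Q c hQ hwalk _ _
    rw [pow_zero, one_mul]
    refine Nat.cast_le.2 (Finset.card_le_card fun k hk => ?_)
    rw [Finset.mem_filter] at hk ⊢
    refine ⟨hk.1, N.not_rank_decodingMatrix_lt k hst c (fun j => ?_) hk.2⟩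
    have hnil : Q j = [] := by
      refine List.eq_nil_iff_forall_not_mem.2 fun e he => ?_
      have := N.mem_walkTails.2 ⟨j, e, he, rfl⟩
      rw [Finset.card_eq_zero.1 hQ] at this
      simp at this
    have := hwalk j
    rwa [hnil] at this
  | succ m ih =>
    intro Q c hQ hwalk hdisj hfree
    obtain ⟨v, hv, hmin⟩ := N.exists_transGen_minimal (N.walkTails Q : Set V)
      (Finset.coe_nonempty.2 (Finset.card_pos.1 (by omega)))
    rw [Finset.mem_coe] at hv
    -- By minimality of `v`, a walk can leave `v` only by its first channel. One step thus removes
    -- `v` from the remaining tails and adds none.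
    have hlater : ∀ j d l, Q j = d :: l → ∀ e ∈ l, N.tail e ≠ v := by
      intro j d l hl e he hev
      have h1 := hwalk j
      rw [hl] at h1
      have h2 := (h1.2.reflTransGen_head e he).1
      rw [hev] at h2
      exact hmin (N.tail d) (Finset.mem_coe.2 (N.mem_walkTails.2 ⟨j, d, by simp [hl], rfl⟩))
        (Relation.TransGen.head' ⟨d, rfl, rfl⟩ h2)
    let S : Fin w → Prop := fun j => ∃ e l, Q j = e :: l ∧ N.tail e = v
    choose e l hel he using fun j : {j // S j} => j.2
    let c' : Fin w → Fin w ⊕ E := fun j => if h : S j then Sum.inr (e ⟨j, h⟩) else c j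
    let Q' : Fin w → List E := fun j => if h : S j then l ⟨j, h⟩ else Q j
    have hsub : ∀ j, ∀ d ∈ Q' j, d ∈ Q j := by
      intro j d hd
      by_cases hj : S j
      · simp only [Q', dif_pos hj] at hd
        rw [hel ⟨j, hj⟩]
        exact List.mem_cons_of_mem _ hd
      · simpa only [Q', dif_neg hj] using hd
    have htails : N.walkTails Q' = (N.walkTails Q).erase v := by
      ext u
      rw [Finset.mem_erase, mem_walkTails, mem_walkTails]
      constructor
      · rintro ⟨j, d, hd, rfl⟩
        refine ⟨?_, j, d, hsub j d hd, rfl⟩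
        by_cases hj : S j
        · simp only [Q', dif_pos hj] at hd
          exact hlater j _ _ (hel ⟨j, hj⟩) d hd
        · simp only [Q', dif_neg hj] at hd
          intro hdv
          cases hq : Q j with
          | nil => simp [hq] at hd
          | cons d' l' =>
            rw [hq] at hd
            rcases List.mem_cons.1 hd with rfl | hd
            · exact hj ⟨_, _, hq, hdv⟩
            · exact hlater j _ _ hq d hd hdv
      · rintro ⟨huv, j, d, hd, rfl⟩
        refine ⟨j, d, ?_, rfl⟩
        by_cases hj : S j
        · simp only [Q', dif_pos hj]
          rw [hel ⟨j, hj⟩] at hd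
          rcases List.mem_cons.1 hd with rfl | hd
          · exact absurd (he ⟨j, hj⟩) huv
          · exact hd
        · simpa only [Q', dif_neg hj] using hd
    have hwalk' : ∀ j, N.Walk (N.inHead w (c' j)) (Q' j) t := by
      intro j
      have h1 := hwalk j
      by_cases hj : S j
      · simp only [Q', c', dif_pos hj]
        rw [hel ⟨j, hj⟩] at h1
        exact h1.2
      · simpa only [Q', c', dif_neg hj] using h1
    have hstep := N.mul_card_cutMatrix_le (F := F) S c e (v := v) (fun j hj => by
        have h1 := hwalk j
        rw [hel ⟨j, hj⟩] at h1
        rw [← h1.1, he]) he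
      (fun i j hij => by
        by_contra hne
        have h1 := @hdisj i.1 j.1 fun h => hne (Subtype.ext h)
        exact h1 (a := e i) (by rw [hel i]; simp) (by rw [hel j, hij]; simp))
      (hfree v hv)
    have hrec := ih Q' c' (by rw [htails, Finset.card_erase_of_mem hv, hQ]; rfl) hwalk'
      (fun i j hij d hd hd' => @hdisj i j hij d (hsub i d hd) (hsub j d hd'))
      (by
        intro u hu j d hd
        rw [htails, Finset.mem_erase] at hu
        by_cases hj : S j
        · simp only [c', dif_pos hj, Sum.inr.injEq] at hd
          -- A new current channel leaves `v`, and a remaining node `u` is neither `v` nor upstream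
          -- of it.
          rw [← hd, he, Relation.reflTransGen_iff_eq_or_transGen]
          rintro (h | h)
          · exact hu.1 h.symm
          · exact hmin u (Finset.mem_coe.2 hu.2) h
        · simp only [c', dif_neg hj] at hd
          exact hfree u hu.2 j d hd)
    refine le_trans ?_ hrec
    rw [pow_succ, mul_assoc]
    refine mul_le_mul_of_nonneg_left (hstep.trans (le_of_eq ?_)) (pow_nonneg (prod_one_sub_inv_pow_nonneg w) m)
    congr!

open Classical in
theorem pow_mul_card_le_card_not_rank_lt {t : V} (hst : N.source ≠ t) {P : Fin w → List E}
    (hP : N.IsDisjointPaths t P) {n : ℕ} (hn : (N.pathInternalNodes t P).card ≤ n) :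
    (∏ i ∈ Finset.Icc 1 w, (1 - 1 / (Fintype.card F : ℝ) ^ i)) ^ (n + 1) *
        Fintype.card (N.AdjPair w → F) ≤
      (Finset.univ.filter fun k : N.AdjPair w → F => ¬ (N.decodingMatrix k t).rank < w).card := by
  have h1 := N.pow_mul_card_cutMatrix_le (F := F) hst _ P Sum.inl rfl
    (fun j => (hP.isPath j).walk) hP.disjoint (fun _ _ _ _ h => by cases h)
  have h2 : (Finset.univ.filter fun k : N.AdjPair w → F =>
      (N.cutMatrix k Sum.inl).det ≠ 0) = Finset.univ := by
    refine Finset.filter_true_of_mem fun k _ => ?_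
    have : N.cutMatrix k Sum.inl = 1 := by
      ext i j
      simp [cutMatrix, extKernel, Matrix.one_apply, Pi.single_apply]
    rw [this, Matrix.det_one]
    exact one_ne_zero
  -- The exponent `n + 1` counts the source besides the internal nodes; acyclicity prevents a path
  -- from leaving `t`.
  have h3 : N.walkTails P ⊆ insert N.source (N.pathInternalNodes t P) := by
    intro v hv
    obtain ⟨j, e, he, rfl⟩ := N.mem_walkTails.1 hv
    rw [Finset.mem_insert]
    by_cases hs : N.tail e = N.source
    · exact Or.inl hs
    · refine Or.inr ?_
      simp only [pathInternalNodes, Finset.mem_filter, Finset.mem_univ, true_and]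
      refine ⟨hs, fun ht => ?_, j, e, he, Or.inl rfl⟩
      have h4 := ((hP.isPath j).walk.reflTransGen_head e he).2
      exact N.acyclic t (Relation.TransGen.head' ⟨e, ht, rfl⟩ h4)
  have h4 : (N.walkTails P).card ≤ n + 1 :=
    (Finset.card_le_card h3).trans ((Finset.card_insert_le _ _).trans (by omega))
  rw [h2, Finset.card_univ] at h1
  refine le_trans (mul_le_mul_of_nonneg_right ?_ (Nat.cast_nonneg _)) h1
  refine pow_le_pow_of_le_one (prod_one_sub_inv_pow_nonneg w) ?_ h4
  simpa using prod_one_sub_inv_pow_anti (F := F) (Nat.zero_le w)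

theorem failureProb_le_of_isDisjointPaths [MeasurableSpace F] [MeasurableSingletonClass F]
    {Ω : Type*} [MeasurableSpace Ω] {μ : Measure Ω} [IsProbabilityMeasure μ]
    {k : N.AdjPair w → Ω → F} (hk : N.IsRandomCoding μ k) {t : V} (hst : N.source ≠ t)
    {P : Fin w → List E} (hP : N.IsDisjointPaths t P) {n : ℕ}
    (hn : (N.pathInternalNodes t P).card ≤ n) :
    N.failureProb μ k t ≤
      1 - (∏ i ∈ Finset.Icc 1 w, (1 - 1 / (Fintype.card F : ℝ) ^ i)) ^ (n + 1) := by
  classical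
  have h1 := N.pow_mul_card_le_card_not_rank_lt (F := F) hst hP hn
  have h2 := hk.measureReal_eq (Finset.univ.filter fun k => (N.decodingMatrix k t).rank < w)
  have h3 := Finset.card_filter_add_card_filter_not (s := (Finset.univ : Finset (N.AdjPair w → F)))
    fun k => (N.decodingMatrix k t).rank < w
  have h4 : (0 : ℝ) < Fintype.card (N.AdjPair w → F) := by exact_mod_cast Fintype.card_pos
  have h5 : N.failureProb μ k t = _ := Eq.trans (by simp [failureProb]) h2
  rw [h5, div_le_iff₀ h4, sub_mul, one_mul]
  rw [Finset.card_univ] at h3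
  have h6 : _ = ((Fintype.card (N.AdjPair w → F) : ℕ) : ℝ) := congrArg Nat.cast h3
  rw [Nat.cast_add] at h6
  have h7 : ∀ a b c d : ℝ, a + b = c → d ≤ b → a ≤ c - d := fun a b c d h h' => by linarith
  refine h7 _ _ _ _ h6 (h1.trans (le_of_eq ?_))
  congr!

end CodingNetwork

/-- The additional hypothesis of the second bound says that no directed path leads from a sink to
the sink `t`; for `t` itself this is part of acyclicity. -/
theorem theorem9 {V E F Ω : Type*} [Fintype V] [Fintype E] [Field F] [Fintype F]
    [MeasurableSpace F] [MeasurableSingletonClass F]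
    [MeasurableSpace Ω] (μ : MeasureTheory.Measure Ω) [MeasureTheory.IsProbabilityMeasure μ]
    (N : CodingNetwork V E) (w : ℕ) (t : V) (ht : t ∈ N.sinks) (hw : w ≤ N.minCut t)
    (k : N.AdjPair w → Ω → F) (hk : N.IsRandomCoding μ k) :
    (∀ P : Fin w → List E, N.IsDisjointPaths t P →
      ∀ n : ℕ, (N.pathInternalNodes t P).card ≤ n →
        N.failureProb μ k t ≤
          1 - (∏ i ∈ Finset.Icc 1 w, (1 - 1 / (Fintype.card F : ℝ) ^ i)) ^ (n + 1)) ∧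
    ((∀ t' ∈ N.sinks, ¬ Relation.TransGen N.Adj t' t) →
      N.failureProb μ k t ≤
        1 - (∏ i ∈ Finset.Icc 1 w, (1 - 1 / (Fintype.card F : ℝ) ^ i)) ^
          (N.internalNodes.card + 1)) := by
  have hst : N.source ≠ t := fun h => N.source_notMem_sinks (h ▸ ht)
  refine ⟨fun P hP n hn => N.failureProb_le_of_isDisjointPaths hk hst hP hn, fun h => ?_⟩
  obtain ⟨P, hP⟩ := N.exists_isDisjointPaths hst hw
  exact N.failureProb_le_of_isDisjointPaths hk hst hP
    (Finset.card_le_card (N.pathInternalNodes_subset_internalNodes h hP))
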